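/- Let $F$ be a nonarchimedean local field with ring of integers $\mathfrak{o}$ and maximal ideal $\mathfrak{p}$, and let $\theta$ be a character of $(F,+)$ that is trivial on $\mathfrak{o}$ but not on $\mathfrak{p}^{-1}$. For $n\ge 0$ put $G_n=GL(n,F)$ (with $G_0=\{1\}$) and $G_n(\mathfrak{o})=GL(n,\mathfrak{o})$. For $n\geq 1$ let $P_n\subset G_n$ be the mirabolic subgroup of matrices with last row $(0,\dots,0,1)$ (so $P_1=\{1\}$), let $P_n(\mathfrak{o})=P_n\cap G_n(\mathfrak{o})$, and let $U_n\subset P_n$ be the subgroup of matrices $\begin{pmatrix} I_{n-1} & x\\ 0 & 1\end{pmatrix}$, with character $\theta(u)=\theta\left(\sum_{i=1}^{n-1}u_{i,i+1}\right)$. Embed $G_{n-1}$ (hence also $P_{n-1}$, if $n\ge 2$) in $P_n$ by $g\mapsto \mathrm{diag}(g,1)$. Let $\delta_{P_n}$ be the modulus character of $P_n$, defined by $\mu(gA)=\delta_{P_n}(g)\mu(A)$ for a right Haar measure $\mu$. Let $(\tau,V)$ be a smooth complex representation of $P_n$. For a character $\chi$ of $U_n$, let $V(U_n,\chi)$ be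 the span of the vectors $\tau(u)v-\chi(u)v$ with $u\in U_n$, $v\in V$. For $n\ge 2$, let $\tau_{(1)}=\Phi^-\tau$ be the representation of $P_{n-1}$ on $V/V(U_n,\theta)$ given by $p\cdot(v+V(U_n,\theta))=\delta_{P_n}(p)^{-1/2}\tau(p)v+V(U_n,\theta)$. For $n\ge 1$, let $\tau^{(1)}=\Psi^-\tau$ be the representation of $G_{n-1}$ on $V/V(U_n,1)$ given by $g\cdot(v+V(U_n,1))=\delta_{P_n}(g)^{-1/2}\tau(g)v+V(U_n,1)$. Then: 1. If $n\ge 2$, the projection $\Phi^-:V\to V/V(U_n,\theta)$ maps $\tau^{P_n(\mathfrak{o})}$ onto $\tau_{(1)}^{P_{n-1}(\mathfrak{o})}$. 2. If $n\geq 1$, the projection $\Psi^-:V\to V/V(U_n,1)$ maps $\tau^{G_{n-1}(\mathfrak{o})}$ onto $(\tau^{(1)})^{G_{n-1}(\mathfrak{o})}$. -/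

import Mathlib

namespace Mirabolic

open Matrix
open scoped ValuativeRel

noncomputable section

/-! ### Smooth representations, fixed vectors, twisted coinvariants -/

section Smooth

variable {G V : Type*} [Group G] [AddCommGroup V] [Module ℂ V]

/-- A complex representation of a topological group is smooth if the stabilizer of every vector
is open. -/
def IsSmooth [TopologicalSpace G] (π : Representation ℂ G V) : Prop :=
  ∀ v : V, IsOpen {g : G | π g v = v}

/-- The space `V^H` of vectors fixed by the subgroup `H`. -/
def fixedVectors (π : Representation ℂ G V) (H : Subgroup G) : Submodule ℂ V :=
  Representation.invariants (π.comp H.subtype)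

/-- The space `V(H, χ)` spanned by the vectors `π(h)v - χ(h)v`, for `h` in `H` and `v` in `V`. -/
def twistedSpan (π : Representation ℂ G V) (H : Subgroup G) (χ : H →* ℂ) : Submodule ℂ V :=
  Submodule.span ℂ {w | ∃ (h : H) (v : V), w = π h v - χ h • v}

/-- `j(l)` normalizes `H` and fixes the character `χ` of `H`, for every `l` in `L`. -/
def Normalizes {L : Type*} [Group L] (j : L →* G) (H : Subgroup G) (χ : H →* ℂ) : Prop :=
  ∀ (l : L) (h : H), ∃ h' : H, (h' : G) = j l * h * (j l)⁻¹ ∧ χ h' = χ h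

theorem twistedSpan_le_comap {L : Type*} [Group L] (π : Representation ℂ G V) {H : Subgroup G}
    {χ : H →* ℂ} {j : L →* G} (hj : Normalizes j H χ) (c : ℂ) (l : L) :
    twistedSpan π H χ ≤ (twistedSpan π H χ).comap (c • π (j l)) := by
  refine Submodule.span_le.2 ?_
  rintro _ ⟨h, v, rfl⟩
  obtain ⟨h', hh', hχ⟩ := hj l h
  have key : π (j l) (π h v - χ h • v) = π h' (π (j l) v) - χ h' • π (j l) v := by
    rw [map_sub, map_smul, hχ, hh', ← Module.End.mul_apply, ← Module.End.mul_apply, ← map_mul,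
      ← map_mul, inv_mul_cancel_right]
  change c • π (j l) (π h v - χ h • v) ∈ twistedSpan π H χ
  rw [key]
  exact Submodule.smul_mem _ c (Submodule.subset_span ⟨h', π (j l) v, rfl⟩)

/-- The action `l • (v + V(H, χ)) = δ'(l) π(l) v + V(H, χ)` of `L` on `V_{H,χ} = V / V(H, χ)`,
where `L` acts on `V` through `j` and `δ'` is a character of `L`. -/
def twistedCoinvariants {L : Type*} [Group L] (π : Representation ℂ G V) {H : Subgroup G}
    {χ : H →* ℂ} {j : L →* G} (hj : Normalizes j H χ) (δ' : L →* ℂ) :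
    Representation ℂ L (V ⧸ twistedSpan π H χ) where
  toFun l := Submodule.mapQ _ _ (δ' l • π (j l)) (twistedSpan_le_comap π hj _ l)
  map_one' := by
    ext v
    simp
  map_mul' a b := by
    refine Submodule.linearMap_qext _ (LinearMap.ext fun v => ?_)
    change Submodule.Quotient.mk (δ' (a * b) • π (j (a * b)) v) =
      Submodule.Quotient.mk (δ' a • π (j a) (δ' b • π (j b) v))
    rw [map_mul, map_mul, map_mul, Module.End.mul_apply, map_smul, mul_smul]

end Smooth

/-! ### The groups -/

section Groups

variable (F : Type*) [Field F]

/-- The mirabolic subgroup `P_n` of `GL(n, F)`: the matrices with last row `(0, …, 0, 1)`. -/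
def P (n : ℕ) : Subgroup (GL (Fin n) F) where
  carrier := {g | ∀ i j : Fin n, (i : ℕ) + 1 = n →
    (g : Matrix (Fin n) (Fin n) F) i j = (1 : Matrix (Fin n) (Fin n) F) i j}
  one_mem' := fun _ _ _ => rfl
  mul_mem' := by
    intro a b ha hb i j hi
    have h : ∀ k, (a : Matrix (Fin n) (Fin n) F) i k = (1 : Matrix (Fin n) (Fin n) F) i k :=
      fun k => ha i k hi
    rw [Units.val_mul, Matrix.mul_apply]
    simp only [h]
    rw [← Matrix.mul_apply, Matrix.one_mul]
    exact hb i j hi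
  inv_mem' := by
    intro a ha i j hi
    have h : ∀ k, (a : Matrix (Fin n) (Fin n) F) i k = (1 : Matrix (Fin n) (Fin n) F) i k :=
      fun k => ha i k hi
    have h2 := congrFun (congrFun (Units.mul_inv a) i) j
    rw [Matrix.mul_apply] at h2
    simp only [h] at h2
    rw [← Matrix.mul_apply, Matrix.one_mul] at h2
    exact h2

variable {F}

/-- The matrix `(A, x; 0, 1)` of size `n + 1`. -/
def block {n : ℕ} (A : Matrix (Fin n) (Fin n) F) (x : Fin n → F) :
    Matrix (Fin (n + 1)) (Fin (n + 1)) F :=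
  Matrix.of (Fin.snoc (fun i => Fin.snoc (A i) (x i)) (Fin.snoc (fun _ => 0) 1))

@[simp] theorem block_castSucc_castSucc {n : ℕ} (A : Matrix (Fin n) (Fin n) F) (x : Fin n → F)
    (i j : Fin n) : block A x i.castSucc j.castSucc = A i j := by simp [block]

@[simp] theorem block_castSucc_last {n : ℕ} (A : Matrix (Fin n) (Fin n) F) (x : Fin n → F)
    (i : Fin n) : block A x i.castSucc (Fin.last n) = x i := by simp [block]

@[simp] theorem block_last_castSucc {n : ℕ} (A : Matrix (Fin n) (Fin n) F) (x : Fin n → F)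
    (j : Fin n) : block A x (Fin.last n) j.castSucc = 0 := by simp [block]

@[simp] theorem block_last_last {n : ℕ} (A : Matrix (Fin n) (Fin n) F) (x : Fin n → F) :
    block A x (Fin.last n) (Fin.last n) = 1 := by simp [block]

theorem block_mul {n : ℕ} (A B : Matrix (Fin n) (Fin n) F) (x y : Fin n → F) :
    block A x * block B y = block (A * B) (A *ᵥ y + x) := by
  ext i j
  refine Fin.lastCases ?_ (fun i => ?_) i <;> refine Fin.lastCases ?_ (fun j => ?_) j <;>
    simp [Matrix.mul_apply, Fin.sum_univ_castSucc, Matrix.mulVec, dotProduct]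

theorem block_one {n : ℕ} : block (1 : Matrix (Fin n) (Fin n) F) 0 = 1 := by
  ext i j
  refine Fin.lastCases ?_ (fun i => ?_) i <;> refine Fin.lastCases ?_ (fun j => ?_) j <;>
    simp [Matrix.one_apply, Fin.ext_iff, ne_of_lt, ne_of_gt]

/-- The element `(g, x; 0, 1)` of `P_{n+1}`, for `g` in `GL(n, F)` and `x` in `F^n`. -/
def affine {n : ℕ} (g : GL (Fin n) F) (x : Fin n → F) : P F (n + 1) where
  val :=
    { val := block (g : Matrix (Fin n) (Fin n) F) x
      inv := block ((g⁻¹ : GL (Fin n) F) : Matrix (Fin n) (Fin n) F)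
        (-(((g⁻¹ : GL (Fin n) F) : Matrix (Fin n) (Fin n) F) *ᵥ x))
      val_inv := by
        rw [block_mul, Units.mul_inv, Matrix.mulVec_neg, Matrix.mulVec_mulVec, Units.mul_inv,
          Matrix.one_mulVec, neg_add_cancel, block_one]
      inv_val := by
        rw [block_mul, Units.inv_mul, add_neg_cancel, block_one] }
  property := by
    intro i j hi
    obtain rfl : i = Fin.last n := Fin.ext (by simpa using hi)
    change block (g : Matrix (Fin n) (Fin n) F) x (Fin.last n) j = _
    rw [← block_one]
    refine Fin.lastCases ?_ (fun j => ?_) j <;> simp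

theorem affine_mul {n : ℕ} (g h : GL (Fin n) F) (x y : Fin n → F) :
    affine g x * affine h y = affine (g * h) ((g : Matrix (Fin n) (Fin n) F) *ᵥ y + x) :=
  Subtype.ext (Units.ext (block_mul _ _ _ _))

theorem affine_one {n : ℕ} : affine (1 : GL (Fin n) F) 0 = 1 :=
  Subtype.ext (Units.ext block_one)

variable (F)

/-- The embedding `g ↦ diag(g, 1)` of `G_n = GL(n, F)` into `P_{n+1}`. -/
def diagG (n : ℕ) : GL (Fin n) F →* P F (n + 1) where
  toFun g := affine g 0
  map_one' := affine_one
  map_mul' g h := by rw [affine_mul, Matrix.mulVec_zero, add_zero]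

/-- The embedding `p ↦ diag(p, 1)` of `P_n` into `P_{n+1}`. -/
def diagP (n : ℕ) : P F n →* P F (n + 1) :=
  (diagG F n).comp (P F n).subtype

/-- The subgroup `U_{n+1}` of `P_{n+1}`: the matrices `(I_n, x; 0, 1)`. -/
def U (n : ℕ) : Subgroup (P F (n + 1)) where
  carrier := {p | ∃ x : Fin n → F, p = affine 1 x}
  one_mem' := ⟨0, affine_one.symm⟩
  mul_mem' := by
    rintro _ _ ⟨x, rfl⟩ ⟨y, rfl⟩
    exact ⟨_, by rw [affine_mul, mul_one]⟩
  inv_mem' := by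
    rintro _ ⟨x, rfl⟩
    refine ⟨-x, inv_eq_of_mul_eq_one_right ?_⟩
    rw [affine_mul, mul_one, Units.val_one, Matrix.one_mulVec, neg_add_cancel, affine_one]

theorem normalizes_diagG (n : ℕ) : Normalizes (diagG F n) (U F n) 1 := by
  rintro g ⟨_, x, rfl⟩
  refine ⟨⟨affine 1 ((g : Matrix (Fin n) (Fin n) F) *ᵥ x), _, rfl⟩, ?_, rfl⟩
  rw [eq_mul_inv_iff_mul_eq]
  change affine _ _ * affine _ _ = affine _ _ * affine _ _
  simp [affine_mul]

variable {F}

theorem superdiag_affine {n : ℕ} (x : Fin (n + 1) → F) :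
    ∑ i : Fin (n + 1), ((affine 1 x : P F (n + 2)) : GL (Fin (n + 2)) F).val i.castSucc i.succ
      = x (Fin.last n) := by
  change ∑ i : Fin (n + 1), block _ x i.castSucc i.succ = _
  rw [Fin.sum_univ_castSucc, Fin.succ_last, block_castSucc_last, Finset.sum_eq_zero, zero_add]
  intro i _
  rw [Fin.succ_castSucc, block_castSucc_castSucc]
  exact Matrix.one_apply_ne (Fin.castSucc_lt_succ).ne

/-- The restriction to `U_{n+2}` of the character `u ↦ θ(∑ i, u_{i,i+1})`. -/
def thetaU (θ : AddChar F ℂ) (n : ℕ) : U F (n + 1) →* ℂ where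
  toFun u := θ (∑ i : Fin (n + 1), ((u : P F (n + 2)) : GL (Fin (n + 2)) F).val i.castSucc i.succ)
  map_one' := by
    have := superdiag_affine (0 : Fin (n + 1) → F)
    rw [affine_one] at this
    rw [Subgroup.coe_one, this, Pi.zero_apply, AddChar.map_zero_eq_one]
  map_mul' := by
    rintro ⟨_, x, rfl⟩ ⟨_, y, rfl⟩
    simp only [Subgroup.coe_mul (U F (n + 1)), affine_mul, mul_one, superdiag_affine]
    simp [AddChar.map_add_eq_mul, mul_comm]

theorem normalizes_diagP (θ : AddChar F ℂ) (n : ℕ) :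
    Normalizes (diagP F (n + 1)) (U F (n + 1)) (thetaU θ n) := by
  rintro ⟨g, hg⟩ ⟨_, x, rfl⟩
  refine ⟨⟨affine 1 ((g : Matrix (Fin (n + 1)) (Fin (n + 1)) F) *ᵥ x), _, rfl⟩, ?_, ?_⟩
  · rw [eq_mul_inv_iff_mul_eq]
    change affine _ _ * affine _ _ = affine _ _ * affine _ _
    simp [affine_mul]
  · change θ _ = θ _
    rw [superdiag_affine, superdiag_affine]
    congr 1
    have h : (g : Matrix (Fin (n + 1)) (Fin (n + 1)) F) (Fin.last n) =
        (1 : Matrix (Fin (n + 1)) (Fin (n + 1)) F) (Fin.last n) :=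
      funext fun j => hg (Fin.last n) j (by simp)
    rw [← congrFun (Matrix.one_mulVec x) (Fin.last n), Matrix.mulVec, Matrix.mulVec, h]

end Groups

/-! ### The functors `Φ⁻` and `Ψ⁻` over a nonarchimedean local field -/

section Functors

variable (F : Type*) [Field F] [ValuativeRel F] [TopologicalSpace F] [IsNonarchimedeanLocalField F]

theorem t2Space : T2Space F := by
  let := IsTopologicalAddGroup.rightUniformSpace F
  have := isUniformAddGroup_of_addCommGroup (G := F)
  infer_instance

instance instLocallyCompactSpaceP (n : ℕ) : LocallyCompactSpace (P F n) := by
  have hF : T2Space F := t2Space F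
  have hM : LocallyCompactSpace (Matrix (Fin n) (Fin n) F) :=
    inferInstanceAs (LocallyCompactSpace (Fin n → Fin n → F))
  have hG : LocallyCompactSpace (GL (Fin n) F) := inferInstance
  refine IsClosed.locallyCompactSpace (X := GL (Fin n) F) (s := (P F n : Set (GL (Fin n) F))) ?_
  change IsClosed {g : GL (Fin n) F | ∀ i j : Fin n, (i : ℕ) + 1 = n → g.val i j = _}
  simp only [Set.ofPred_forall]
  refine isClosed_iInter fun i => isClosed_iInter fun j => isClosed_iInter fun _ => ?_
  exact isClosed_eq ((Units.continuous_val).matrix_elem i j) continuous_const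

/-- The character `δ^{-1/2}`, where `δ` is the modulus of `P_n`. With `μ` a left Haar measure
one has `μ(A g⁻¹) = δ(g) μ(A)`; equivalently `ρ(gA) = δ(g) ρ(A)` for a right Haar measure `ρ`. -/
def modulusInvSqrt (n : ℕ) : P F n →* ℂ where
  toFun p := (((MeasureTheory.Measure.modularCharacter p : NNReal) ^ (-1 / 2 : ℝ) : NNReal) : ℂ)
  map_one' := by simp
  map_mul' p q := by simp [NNReal.mul_rpow]

variable {F}

/-- `Φ⁻ τ`: the representation of `P_{n+1}` on `V / V(U_{n+2}, θ)`, normalized by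
`δ_{P_{n+2}}^{-1/2}`, for a representation `τ` of `P_{n+2}`. -/
def PhiMinus (θ : AddChar F ℂ) {n : ℕ} {V : Type*} [AddCommGroup V] [Module ℂ V]
    (τ : Representation ℂ (P F (n + 2)) V) :
    Representation ℂ (P F (n + 1)) (V ⧸ twistedSpan τ (U F (n + 1)) (thetaU θ n)) :=
  twistedCoinvariants τ (normalizes_diagP θ n) ((modulusInvSqrt F (n + 2)).comp (diagP F (n + 1)))

/-- `Ψ⁻ τ`: the representation of `G_n = GL(n, F)` on `V / V(U_{n+1}, 1)`, normalized by
`δ_{P_{n+1}}^{-1/2}`, for a representation `τ` of `P_{n+1}`. -/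
def PsiMinus {n : ℕ} {V : Type*} [AddCommGroup V] [Module ℂ V]
    (τ : Representation ℂ (P F (n + 1)) V) :
    Representation ℂ (GL (Fin n) F) (V ⧸ twistedSpan τ (U F n) 1) :=
  twistedCoinvariants τ (normalizes_diagG F n) ((modulusInvSqrt F (n + 1)).comp (diagG F n))

variable (F)

/-- The subgroup `GL(n, 𝔬)` of `GL(n, F)`. -/
def GO (n : ℕ) : Subgroup (GL (Fin n) F) :=
  (Matrix.GeneralLinearGroup.map (n := Fin n) (algebraMap 𝒪[F] F)).range

/-- The subgroup `P_n(𝔬) = P_n ∩ GL(n, 𝔬)` of `P_n`. -/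
def PO (n : ℕ) : Subgroup (P F n) :=
  (GO F n).subgroupOf (P F n)

variable {F}

/-- The additive character `θ` of `F` is trivial on `𝔬` but not on `𝔭⁻¹`. -/
structure HasConductorO (θ : AddChar F ℂ) : Prop where
  trivial_on : ∀ x : F, x ∈ 𝒪[F] → θ x = 1
  nontrivial_on : ∃ x : F, (∀ y : 𝒪[F], y ∈ 𝓂[F] → (y : F) * x ∈ 𝒪[F]) ∧ θ x ≠ 1

end Functors

end

end Mirabolic

/-!
Both inclusions "image of fixed vectors is fixed" hold because the modulus of `P_n` is trivial on
compact subgroups (`modularCharacter_eq_one`), so the normalizing factors disappear on integral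
points. The content is surjectivity.

For `Ψ⁻`, lift a fixed vector of the quotient to `v` and replace `v` by the sum over its orbit under
the compact group `GL(n, 𝔬)`; smoothness makes the orbit finite (`exists_finset_orbit`), and every
vector of the orbit has the same image.

For `Φ⁻`, only `P_{n+1}(𝔬)` acts on the quotient, and the lift has to be fixed by the larger group
`P_{n+2}(𝔬) = U(𝔬) GL(n + 1, 𝔬)`. The idea is to regard `V` as a sheaf over the characters of
`U_{n+2}`, whose fibre at `θ` is `V / V(U, θ)`, and to cut the lift down to a small neighbourhood of
`θ` before averaging over `GL(n + 1, 𝔬)`. Let `v` lift the fixed vector `w`. The integral `k` for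
which `k v` still maps to `w` form an open set containing `P_{n+1}(𝔬)`, so by compactness it contains
all `k` whose last row is congruent to `(0, …, 0, 1)` modulo some `a ≠ 0`
(`exists_congruence_subset`). Averaging `v` against `θ⁻¹` over the lattice `a⁻¹𝔬^{n+1}` of `U_{n+2}`
gives `v'` (`exists_theta_eigenvector`). If `k` satisfies the congruence, it preserves `θ` on the
lattice (`theta_mulVec_last`) and `k v'` maps to `w`. Otherwise, since `θ` has conductor exactly `𝔬`,
`k` moves `θ` on the lattice (`exists_theta_mulVec_last_ne`), so `k v'` is an eigenvector for a
different character and maps to `0`. Hence the sum over the `GL(n + 1, 𝔬)`-orbit of `v'` maps to a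
positive multiple of `w`. It is fixed by `U(𝔬)` because `v'` is and `GL(n + 1, 𝔬)`
normalizes `U(𝔬)`.
-/

namespace Mirabolic

open Matrix MeasureTheory
open scoped ValuativeRel

/-! ### Orbits of compact groups in smooth representations -/

section Orbits

variable {G V : Type*} [Group G] [AddCommGroup V] [Module ℂ V]

theorem isLocallyConstant_of_isOpen_stabilizer [TopologicalSpace G] [ContinuousMul G]
    (π : Representation ℂ G V) (v : V) (hv : IsOpen {g : G | π g v = v}) :
    IsLocallyConstant fun g => π g v := by
  refine (IsLocallyConstant.iff_exists_open _).2 fun g => ?_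
  refine ⟨(fun x => g⁻¹ * x) ⁻¹' {g | π g v = v}, hv.preimage (continuous_const_mul _), ?_, ?_⟩
  · simp
  · intro x hx
    have h : π (g⁻¹ * x) v = v := hx
    rw [← mul_inv_cancel_left g x, map_mul, Module.End.mul_apply, h]

theorem IsSmooth.isLocallyConstant [TopologicalSpace G] [ContinuousMul G]
    {π : Representation ℂ G V} (hπ : IsSmooth π) (v : V) : IsLocallyConstant fun g => π g v :=
  isLocallyConstant_of_isOpen_stabilizer π v (hπ v)

/-- The orbit of a vector under a compact group acting smoothly is finite, and the sum over the
orbit is invariant. This replaces integration over the group. -/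
theorem exists_finset_orbit [TopologicalSpace G] [CompactSpace G] (π : Representation ℂ G V)
    (v : V) (hv : IsLocallyConstant fun g => π g v) :
    ∃ T : Finset V, v ∈ T ∧ (∀ y ∈ T, ∃ g, y = π g v) ∧ ∀ g, π g (∑ y ∈ T, y) = ∑ y ∈ T, y := by
  have hT : ∀ y, y ∈ hv.range_finite.toFinset ↔ ∃ g, π g v = y := by simp
  refine ⟨hv.range_finite.toFinset, (hT v).2 ⟨1, by simp⟩,
    fun y hy => ((hT y).1 hy).imp fun g hg => hg.symm, fun g => ?_⟩
  rw [map_sum]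
  refine Finset.sum_bij' (fun y _ => π g y) (fun y _ => π g⁻¹ y) ?_ ?_ ?_ ?_ ?_
  · rintro y hy
    obtain ⟨k, rfl⟩ := (hT y).1 hy
    exact (hT _).2 ⟨g * k, by simp⟩
  · rintro y hy
    obtain ⟨k, rfl⟩ := (hT y).1 hy
    exact (hT _).2 ⟨g⁻¹ * k, by simp⟩
  all_goals simp

/-- If `f` sends each vector of a finite set containing `v` either to `f v` or to `0`, then `f v` is
the image of a multiple of the sum over the set: the number of vectors with image `f v` is positive
because `v` is one of them. -/
theorem exists_smul_sum_eq {W : Type*} [AddCommGroup W] [Module ℂ W] (f : V →ₗ[ℂ] W)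
    (T : Finset V) {v : V} (hv : v ∈ T) (hT : ∀ y ∈ T, f y = f v ∨ f y = 0) :
    ∃ c : ℂ, f (c • ∑ y ∈ T, y) = f v := by
  classical
  have hsum : f (∑ y ∈ T, y) = ((T.filter fun y => f y = f v).card : ℂ) • f v := by
    rw [map_sum, ← Finset.sum_filter_add_sum_filter_not T fun y => f y = f v,
      Finset.sum_congr rfl fun y hy => (Finset.mem_filter.1 hy).2,
      Finset.sum_eq_zero (s := T.filter fun y => ¬ f y = f v), add_zero, Finset.sum_const,
      Nat.cast_smul_eq_nsmul]
    intro y hy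
    exact (hT y (Finset.mem_filter.1 hy).1).resolve_left (Finset.mem_filter.1 hy).2
  have hne : ((T.filter fun y => f y = f v).card : ℂ) ≠ 0 :=
    Nat.cast_ne_zero.2 (Finset.card_ne_zero_of_mem (Finset.mem_filter.2 ⟨hv, rfl⟩))
  exact ⟨((T.filter fun y => f y = f v).card : ℂ)⁻¹, by rw [map_smul, hsum, inv_smul_smul₀ hne]⟩

end Orbits

/-! ### The modular character on compact subgroups -/

/-- The modular character is trivial on a compact subgroup `H`: for a compact neighbourhood `C` of
`1`, the set `C * H` has finite positive measure and is invariant under right translation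
by `H`. -/
theorem modularCharacter_eq_one {G : Type*} [Group G] [TopologicalSpace G] [IsTopologicalGroup G]
    [LocallyCompactSpace G] {H : Subgroup G} (hH : IsCompact (H : Set G)) {h : G} (hh : h ∈ H) :
    Measure.modularCharacter h = 1 := by
  borelize G
  obtain ⟨C, hC, hC1⟩ := exists_compact_mem_nhds (1 : G)
  let A : Set G := (fun p : G × G => p.1 * p.2) '' (C ×ˢ (H : Set G))
  have hA : IsCompact A := (hC.prod hH).image continuous_mul
  have hCA : C ⊆ A := fun c hc => ⟨(c, 1), ⟨hc, H.one_mem⟩, mul_one c⟩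
  let μ : Measure G := Measure.haar
  have hpos : μ A ≠ 0 :=
    (Measure.measure_pos_of_mem_nhds μ (Filter.mem_of_superset hC1 hCA)).ne'
  have hpre : (· * h) ⁻¹' A = A := by
    ext x
    constructor
    · rintro ⟨⟨c, k⟩, ⟨hc, hk⟩, hx⟩
      exact ⟨(c, k * h⁻¹), ⟨hc, H.mul_mem hk (H.inv_mem hh)⟩, by
        simpa [← mul_assoc] using congrArg (· * h⁻¹) hx⟩
    · rintro ⟨⟨c, k⟩, ⟨hc, hk⟩, rfl⟩
      exact ⟨(c, k * h), ⟨hc, H.mul_mem hk hh⟩, (mul_assoc c k h).symm⟩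
  have h1 : Measure.map (· * h) μ A = μ A := by
    rw [← MeasurableEquiv.coe_mulRight, MeasurableEquiv.map_apply, MeasurableEquiv.coe_mulRight,
      hpre]
  have h2 := Measure.measure_isMulInvariant_eq_smul_of_isCompact_closure
    (Measure.map (· * h) μ) μ hA.closure
  change Measure.modularCharacterFun h = 1
  rw [Measure.modularCharacterFun_eq_haarScalarFactor μ]
  rw [h1, ENNReal.smul_def, smul_eq_mul] at h2
  have h3 := (ENNReal.eq_div_iff hpos hA.measure_ne_top).2 ((mul_comm _ _).trans h2.symm)
  rw [ENNReal.div_self hpos hA.measure_ne_top] at h3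
  exact_mod_cast h3

/-! ### Affine coordinates on the mirabolic subgroup -/

section Affine

variable {F : Type*} [Field F]

theorem affine_one_mul_diagG {n : ℕ} (g : GL (Fin n) F) (x : Fin n → F) :
    affine 1 x * diagG F n g = affine g x := by
  change affine 1 x * affine g 0 = _
  simp [affine_mul]

theorem diagG_mul_affine_one {n : ℕ} (g : GL (Fin n) F) (x : Fin n → F) :
    diagG F n g * affine 1 x =
      affine 1 ((g : Matrix (Fin n) (Fin n) F) *ᵥ x) * diagG F n g := by
  rw [affine_one_mul_diagG]
  change affine g 0 * affine 1 x = _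
  simp [affine_mul]

theorem exists_eq_block {n : ℕ} (p : P F (n + 1)) :
    ∃ (A : Matrix (Fin n) (Fin n) F) (x : Fin n → F),
      ((p : GL (Fin (n + 1)) F) : Matrix (Fin (n + 1)) (Fin (n + 1)) F) = block A x := by
  refine ⟨Matrix.of fun i j => (p : GL (Fin (n + 1)) F).val i.castSucc j.castSucc,
    fun i => (p : GL (Fin (n + 1)) F).val i.castSucc (Fin.last n), ?_⟩
  have hp : ∀ j, (p : GL (Fin (n + 1)) F).val (Fin.last n) j =
      block (1 : Matrix (Fin n) (Fin n) F) 0 (Fin.last n) j := by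
    rw [block_one]
    exact fun j => p.2 (Fin.last n) j (by simp)
  ext i j
  refine Fin.lastCases ?_ (fun i => ?_) i <;> refine Fin.lastCases ?_ (fun j => ?_) j <;>
    simp [hp]

theorem block_injective {n : ℕ} {A B : Matrix (Fin n) (Fin n) F} {x y : Fin n → F}
    (h : block A x = block B y) : A = B ∧ x = y :=
  ⟨Matrix.ext fun i j => by simpa using congrFun (congrFun h i.castSucc) j.castSucc,
    funext fun i => by simpa using congrFun (congrFun h i.castSucc) (Fin.last n)⟩

theorem exists_eq_affine {n : ℕ} (p : P F (n + 1)) :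
    ∃ (g : GL (Fin n) F) (x : Fin n → F), p = affine g x := by
  obtain ⟨A, x, hA⟩ := exists_eq_block p
  obtain ⟨B, y, hB⟩ := exists_eq_block p⁻¹
  have h1 : block (A * B) (A *ᵥ y + x) = block 1 0 := by
    rw [← block_mul, block_one, ← hA, ← hB]
    exact Units.mul_inv _
  have h2 : block (B * A) (B *ᵥ x + y) = block 1 0 := by
    rw [← block_mul, block_one, ← hA, ← hB]
    exact Units.inv_mul _
  exact ⟨⟨A, B, (block_injective h1).1, (block_injective h2).1⟩, x, Subtype.ext (Units.ext hA)⟩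

theorem thetaU_affine (θ : AddChar F ℂ) {n : ℕ} (x : Fin (n + 1) → F)
    (hx : affine 1 x ∈ U F (n + 1)) : thetaU θ n ⟨affine 1 x, hx⟩ = θ (x (Fin.last n)) :=
  congrArg θ (superdiag_affine x)

theorem continuous_affine [TopologicalSpace F] [IsTopologicalRing F] {n : ℕ} :
    Continuous fun p : GL (Fin n) F × (Fin n → F) => affine p.1 p.2 := by
  have hblock : Continuous fun p : Matrix (Fin n) (Fin n) F × (Fin n → F) => block p.1 p.2 := by
    refine continuous_matrix fun i j => ?_
    refine Fin.lastCases ?_ (fun i => ?_) i <;> refine Fin.lastCases ?_ (fun j => ?_) j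
    · simpa using continuous_const
    · simpa using continuous_const
    · simpa [Function.comp_def] using (continuous_apply i).comp continuous_snd
    · simpa using continuous_fst.matrix_elem i j
  refine Continuous.subtype_mk (Units.continuous_iff.2 ⟨?_, ?_⟩) _
  · exact hblock.comp ((Units.continuous_val.comp continuous_fst).prodMk continuous_snd)
  · have hinv : Continuous fun p : GL (Fin n) F × (Fin n → F) =>
        ((p.1⁻¹ : GL (Fin n) F) : Matrix (Fin n) (Fin n) F) :=
      Units.continuous_coe_inv.comp continuous_fst
    exact hblock.comp (hinv.prodMk (hinv.matrix_mulVec continuous_snd).neg)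

end Affine

/-! ### Integral points -/

section Integral

variable {F : Type*} [Field F] [ValuativeRel F]

theorem mem_GO_iff {n : ℕ} {g : GL (Fin n) F} :
    g ∈ GO F n ↔ (∀ i j, (g : Matrix (Fin n) (Fin n) F) i j ∈ 𝒪[F]) ∧
      ∀ i j, ((g⁻¹ : GL (Fin n) F) : Matrix (Fin n) (Fin n) F) i j ∈ 𝒪[F] := by
  constructor
  · rintro ⟨k, rfl⟩
    refine ⟨fun i j => (k.val i j).2, fun i j => ?_⟩
    rw [← map_inv]
    exact ((k⁻¹).val i j).2
  · rintro ⟨h1, h2⟩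
    have hinj : Function.Injective (algebraMap 𝒪[F] F) := Subtype.val_injective
    let A : Matrix (Fin n) (Fin n) 𝒪[F] := fun i j => ⟨_, h1 i j⟩
    let B : Matrix (Fin n) (Fin n) 𝒪[F] := fun i j => ⟨_, h2 i j⟩
    have hA : A.map (algebraMap 𝒪[F] F) = g.val := rfl
    have hB : B.map (algebraMap 𝒪[F] F) = (g⁻¹).val := rfl
    refine ⟨⟨A, B, Matrix.map_injective hinj ?_, Matrix.map_injective hinj ?_⟩, Units.ext rfl⟩
    · change (A * B).map _ = Matrix.map 1 _
      rw [Matrix.map_mul, hA, hB, Units.mul_inv, Matrix.map_one _ (map_zero _) (map_one _)]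
    · change (B * A).map _ = Matrix.map 1 _
      rw [Matrix.map_mul, hA, hB, Units.inv_mul, Matrix.map_one _ (map_zero _) (map_one _)]

theorem mulVec_mem_integer {n : ℕ} {A : Matrix (Fin n) (Fin n) F} (hA : ∀ i j, A i j ∈ 𝒪[F])
    {x : Fin n → F} (hx : ∀ i, x i ∈ 𝒪[F]) (i : Fin n) : (A *ᵥ x) i ∈ 𝒪[F] :=
  Subring.sum_mem 𝒪[F] (t := Finset.univ) fun j _ => mul_mem (hA i j) (hx j)

theorem affine_mem_PO_iff {n : ℕ} {g : GL (Fin n) F} {x : Fin n → F} :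
    affine g x ∈ PO F (n + 1) ↔ g ∈ GO F n ∧ ∀ i, x i ∈ 𝒪[F] := by
  have h0 : (0 : F) ∈ 𝒪[F] := zero_mem _
  have h1 : (1 : F) ∈ 𝒪[F] := one_mem _
  have hblock : ∀ (A : Matrix (Fin n) (Fin n) F) (y : Fin n → F),
      (∀ i j, block A y i j ∈ 𝒪[F]) ↔ (∀ i j, A i j ∈ 𝒪[F]) ∧ ∀ i, y i ∈ 𝒪[F] := fun A y => by
    simp only [Fin.forall_fin_succ', block_castSucc_castSucc, block_castSucc_last,
      block_last_castSucc, block_last_last, h0, h1, implies_true, and_true, forall_and]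
  change ((affine g x : P F (n + 1)) : GL (Fin (n + 1)) F) ∈ GO F (n + 1) ↔ _
  rw [mem_GO_iff, mem_GO_iff]
  change (∀ i j, block _ _ i j ∈ 𝒪[F]) ∧ (∀ i j, block _ _ i j ∈ 𝒪[F]) ↔ _
  rw [hblock, hblock]
  constructor
  · rintro ⟨⟨a, b⟩, c, -⟩
    exact ⟨⟨a, c⟩, b⟩
  · rintro ⟨⟨a, c⟩, b⟩
    exact ⟨⟨a, b⟩, c, fun i => neg_mem (mulVec_mem_integer c b i)⟩

variable (F) in
/-- The embedding of `GL(n, 𝔬)` in `P_{n+1}`. The source carries the topology of `𝔬`, for which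
it is a compact group. -/
noncomputable def diagO (n : ℕ) : GL (Fin n) 𝒪[F] →* P F (n + 1) :=
  (diagG F n).comp (Matrix.GeneralLinearGroup.map (algebraMap 𝒪[F] F))

theorem diagO_mem_PO {n : ℕ} (k : GL (Fin n) 𝒪[F]) : diagO F n k ∈ PO F (n + 1) :=
  affine_mem_PO_iff.2 ⟨⟨k, rfl⟩, fun _ => zero_mem _⟩

theorem diagO_mul_affine_one {n : ℕ} (k : GL (Fin n) 𝒪[F]) (x : Fin n → F) :
    diagO F n k * affine 1 x =
      affine 1 (k.val.map (algebraMap 𝒪[F] F) *ᵥ x) * diagO F n k :=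
  diagG_mul_affine_one _ x

theorem exists_eq_of_mem_PO {n : ℕ} {p : P F (n + 1)} (hp : p ∈ PO F (n + 1)) :
    ∃ (k : GL (Fin n) 𝒪[F]) (x : Fin n → F), (∀ i, x i ∈ 𝒪[F]) ∧ p = affine 1 x * diagO F n k := by
  obtain ⟨g, x, rfl⟩ := exists_eq_affine p
  obtain ⟨⟨k, rfl⟩, hx⟩ := affine_mem_PO_iff.1 hp
  exact ⟨k, x, hx, (affine_one_mul_diagG _ x).symm⟩

theorem mulVec_last_eq_add {n : ℕ} (A : Matrix (Fin (n + 1)) (Fin (n + 1)) 𝒪[F])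
    (x : Fin (n + 1) → F) :
    (A.map (algebraMap 𝒪[F] F) *ᵥ x) (Fin.last n) = x (Fin.last n) +
      ∑ j, ((A (Fin.last n) j -
        (1 : Matrix (Fin (n + 1)) (Fin (n + 1)) 𝒪[F]) (Fin.last n) j : 𝒪[F]) : F) * x j := by
  have h : ∑ j, (((1 : Matrix (Fin (n + 1)) (Fin (n + 1)) 𝒪[F]) (Fin.last n) j : 𝒪[F]) : F) * x j =
      x (Fin.last n) := by
    rw [Finset.sum_eq_single (Fin.last n)]
    · simp
    · intro j _ hj
      simp [Matrix.one_apply_ne hj.symm]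
    · simp
  conv_rhs => enter [1]; rw [← h]
  rw [← Finset.sum_add_distrib]
  change ∑ j, (A (Fin.last n) j : F) * x j = _
  refine Finset.sum_congr rfl fun j _ => ?_
  rw [← add_mul, AddSubgroupClass.coe_sub, add_sub_cancel]

/-- If the last row of `A` is congruent to `(0, …, 0, 1)` modulo `a`, then `A` preserves the
restriction of `θ` to the lattice `a⁻¹𝔬^{n+1}`. -/
theorem theta_mulVec_last {θ : AddChar F ℂ} (hθ : ∀ x : F, x ∈ 𝒪[F] → θ x = 1) {n : ℕ} {a : 𝒪[F]}
    {A : Matrix (Fin (n + 1)) (Fin (n + 1)) 𝒪[F]}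
    (hA : ∀ j, a ∣ A (Fin.last n) j -
      (1 : Matrix (Fin (n + 1)) (Fin (n + 1)) 𝒪[F]) (Fin.last n) j)
    {x : Fin (n + 1) → F} (hx : ∀ i, (a : F) * x i ∈ 𝒪[F]) :
    θ ((A.map (algebraMap 𝒪[F] F) *ᵥ x) (Fin.last n)) = θ (x (Fin.last n)) := by
  rw [mulVec_last_eq_add, AddChar.map_add_eq_mul, mul_eq_left₀]
  · refine hθ _ (Subring.sum_mem 𝒪[F] (t := Finset.univ) fun j _ => ?_)
    obtain ⟨c, hc⟩ := hA j
    rw [hc, Subring.coe_mul, mul_comm (a : F), mul_assoc]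
    exact mul_mem c.2 (hx j)
  · exact (θ.val_isUnit _).ne_zero

variable [TopologicalSpace F] [IsNonarchimedeanLocalField F]

theorem compactSpace_GL_integer (n : ℕ) : CompactSpace (GL (Fin n) 𝒪[F]) := by
  have := t2Space F
  have : CompactSpace (Matrix (Fin n) (Fin n) 𝒪[F]) :=
    inferInstanceAs (CompactSpace (Fin n → Fin n → 𝒪[F]))
  infer_instance

theorem continuous_diagO (n : ℕ) : Continuous (diagO F n) := by
  have h : Continuous (Matrix.GeneralLinearGroup.map (n := Fin n) (algebraMap 𝒪[F] F)) :=
    Continuous.units_map _ (continuous_id.matrix_map continuous_subtype_val)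
  exact continuous_affine.comp (h.prodMk continuous_const)

theorem modulusInvSqrt_diagO (n : ℕ) (k : GL (Fin n) 𝒪[F]) :
    modulusInvSqrt F (n + 1) (diagO F n k) = 1 := by
  have := compactSpace_GL_integer (F := F) n
  have hK : IsCompact ((diagO F n).range : Set (P F (n + 1))) := by
    rw [MonoidHom.coe_range]
    exact isCompact_range (continuous_diagO n)
  change (((Measure.modularCharacter (diagO F n k) : NNReal) ^ (-1 / 2 : ℝ) : NNReal) : ℂ) = 1
  rw [modularCharacter_eq_one hK ⟨k, rfl⟩]
  simp

/-- A neighbourhood in `GL(n + 1, 𝔬)` of the integral points of the mirabolic subgroup contains all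
matrices whose last row is congruent to `(0, …, 0, 1)` modulo some nonzero `a`. -/
theorem exists_congruence_subset {n : ℕ} {W : Set (GL (Fin (n + 1)) 𝒪[F])} (hW : IsOpen W)
    (hPW : ∀ k : GL (Fin (n + 1)) 𝒪[F],
      (∀ j, k.val (Fin.last n) j =
        (1 : Matrix (Fin (n + 1)) (Fin (n + 1)) 𝒪[F]) (Fin.last n) j) → k ∈ W) :
    ∃ a : 𝒪[F], a ≠ 0 ∧ ∀ k : GL (Fin (n + 1)) 𝒪[F],
      (∀ j, a ∣ k.val (Fin.last n) j -
        (1 : Matrix (Fin (n + 1)) (Fin (n + 1)) 𝒪[F]) (Fin.last n) j) → k ∈ W := by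
  have := t2Space F
  have := compactSpace_GL_integer (F := F) (n + 1)
  -- The congruence sets form a directed family of compact sets that shrinks to the integral points
  -- of the mirabolic subgroup.
  let C : {a : 𝒪[F] // a ≠ 0} → Set (GL (Fin (n + 1)) 𝒪[F]) := fun a =>
    {k | ∀ j, (a : 𝒪[F]) ∣ k.val (Fin.last n) j -
      (1 : Matrix (Fin (n + 1)) (Fin (n + 1)) 𝒪[F]) (Fin.last n) j}
  have hclosed : ∀ a, IsClosed (C a) := by
    intro a
    have ha : IsClosed {x : 𝒪[F] | (a : 𝒪[F]) ∣ x} := by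
      have : {x : 𝒪[F] | (a : 𝒪[F]) ∣ x} = Set.range fun y => (a : 𝒪[F]) * y := by
        ext x
        exact exists_congr fun y => eq_comm
      rw [this]
      exact (isCompact_range (continuous_const_mul _)).isClosed
    have : C a = ⋂ j, {k | (a : 𝒪[F]) ∣ k.val (Fin.last n) j -
      (1 : Matrix (Fin (n + 1)) (Fin (n + 1)) 𝒪[F]) (Fin.last n) j} := by
      ext k
      simp [C]
    rw [this]
    exact isClosed_iInter fun j => ha.preimage
      ((Units.continuous_val.matrix_elem (Fin.last n) j).sub continuous_const)
  have hdir : Directed (· ⊇ ·) C := fun a b =>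
    ⟨⟨a * b, mul_ne_zero a.2 b.2⟩, fun k hk j => (dvd_mul_right _ _).trans (hk j),
      fun k hk j => (dvd_mul_left _ _).trans (hk j)⟩
  have : Nonempty {a : 𝒪[F] // a ≠ 0} := ⟨⟨1, one_ne_zero⟩⟩
  obtain ⟨a, ha⟩ := exists_subset_nhds_of_isCompact' hdir (fun a => (hclosed a).isCompact) hclosed
    (U := W) (by
      intro k hk
      refine hW.mem_nhds (hPW k fun j => ?_)
      rw [← sub_eq_zero]
      by_contra h
      -- An element divisible by every nonzero one vanishes, since `𝔬` has a nonzero nonunit.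
      obtain ⟨ϖ, hϖ⟩ := IsDiscreteValuationRing.exists_irreducible 𝒪[F]
      have hd := Set.mem_iInter.1 hk ⟨_, mul_ne_zero h hϖ.ne_zero⟩ j
      obtain ⟨c, hc⟩ := hd
      refine hϖ.not_isUnit (IsUnit.of_mul_eq_one c (mul_left_cancel₀ h ?_))
      rw [← mul_assoc, mul_one]
      exact hc.symm)
  exact ⟨a, a.2, fun k hk => ha hk⟩

end Integral

/-! ### Fixed vectors and twisted coinvariants -/

section Coinvariants

variable {G V : Type*} [Group G] [AddCommGroup V] [Module ℂ V]

theorem mem_fixedVectors {π : Representation ℂ G V} {H : Subgroup G} {v : V} :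
    v ∈ fixedVectors π H ↔ ∀ h ∈ H, π h v = v := by
  rw [fixedVectors, Representation.mem_invariants]
  exact Subtype.forall

theorem mk_twistedSpan_apply (π : Representation ℂ G V) {H : Subgroup G} {χ : H →* ℂ} {h : G}
    (hh : h ∈ H) (v : V) :
    (twistedSpan π H χ).mkQ (π h v) = χ ⟨h, hh⟩ • (twistedSpan π H χ).mkQ v := by
  rw [← map_smul, ← sub_eq_zero, ← map_sub, Submodule.mkQ_apply, Submodule.Quotient.mk_eq_zero]
  exact Submodule.subset_span ⟨⟨h, hh⟩, v, rfl⟩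

theorem twistedCoinvariants_mkQ {L : Type*} [Group L] (π : Representation ℂ G V) {H : Subgroup G}
    {χ : H →* ℂ} {j : L →* G} (hj : Normalizes j H χ) (δ' : L →* ℂ) {l : L} (hl : δ' l = 1)
    (v : V) :
    twistedCoinvariants π hj δ' l ((twistedSpan π H χ).mkQ v) =
      (twistedSpan π H χ).mkQ (π (j l) v) := by
  change (twistedSpan π H χ).mkQ (δ' l • π (j l) v) = _
  rw [hl, one_smul]

/-- The twist of a representation by a character. -/
def twist (π : Representation ℂ G V) (χ : G →* ℂ) : Representation ℂ G V where
  toFun g := χ g • π g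
  map_one' := by simp
  map_mul' a b := by
    rw [map_mul, map_mul, smul_mul_smul_comm]

end Coinvariants

variable {F : Type*} [Field F] [ValuativeRel F] [TopologicalSpace F] [IsNonarchimedeanLocalField F]
variable {V : Type*} [AddCommGroup V] [Module ℂ V]

theorem PhiMinus_mkQ (θ : AddChar F ℂ) {n : ℕ} (τ : Representation ℂ (P F (n + 2)) V)
    {p : P F (n + 1)} {k : GL (Fin (n + 1)) 𝒪[F]} (hp : diagP F (n + 1) p = diagO F (n + 1) k)
    (v : V) :
    PhiMinus θ τ p ((twistedSpan τ (U F (n + 1)) (thetaU θ n)).mkQ v) =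
      (twistedSpan τ (U F (n + 1)) (thetaU θ n)).mkQ (τ (diagO F (n + 1) k) v) := by
  rw [PhiMinus, twistedCoinvariants_mkQ, hp]
  rw [MonoidHom.comp_apply, hp, modulusInvSqrt_diagO]

theorem PsiMinus_mkQ {n : ℕ} (τ : Representation ℂ (P F (n + 1)) V) (k : GL (Fin n) 𝒪[F]) (v : V) :
    PsiMinus τ (Matrix.GeneralLinearGroup.map (algebraMap 𝒪[F] F) k)
        ((twistedSpan τ (U F n) 1).mkQ v) = (twistedSpan τ (U F n) 1).mkQ (τ (diagO F n k) v) := by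
  rw [PsiMinus, twistedCoinvariants_mkQ]
  · rfl
  · exact modulusInvSqrt_diagO n k

/-! ### Surjectivity for `Ψ⁻` -/

theorem map_fixedVectors_PsiMinus {n : ℕ} (τ : Representation ℂ (P F (n + 1)) V)
    (hτ : IsSmooth τ) :
    (fixedVectors τ ((GO F n).map (diagG F n))).map (Submodule.mkQ _) =
      fixedVectors (PsiMinus τ) (GO F n) := by
  have hmk := PsiMinus_mkQ τ
  ext w
  constructor
  · rintro ⟨v, hv, rfl⟩
    refine mem_fixedVectors.2 ?_
    rintro _ ⟨k, rfl⟩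
    rw [hmk, mem_fixedVectors.1 hv]
    exact ⟨_, ⟨k, rfl⟩, rfl⟩
  · intro hw
    obtain ⟨v, rfl⟩ := Submodule.mkQ_surjective _ w
    have := compactSpace_GL_integer (F := F) n
    obtain ⟨T, hvT, hT, hinv⟩ := exists_finset_orbit (τ.comp (diagO F n)) v
      ((hτ.isLocallyConstant v).comp_continuous (continuous_diagO n))
    obtain ⟨c, hc⟩ := exists_smul_sum_eq (twistedSpan τ (U F n) 1).mkQ T hvT fun y hy => by
      obtain ⟨k, rfl⟩ := hT y hy
      exact Or.inl ((hmk k v).symm.trans (mem_fixedVectors.1 hw _ ⟨k, rfl⟩))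
    refine ⟨_, mem_fixedVectors.2 ?_, hc⟩
    rintro _ ⟨_, ⟨k, rfl⟩, rfl⟩
    rw [map_smul]
    exact congrArg (c • ·) (hinv k)

/-! ### Eigenvectors of congruence lattices in the unipotent radical -/

theorem isLocallyConstant_addChar {θ : AddChar F ℂ} (hθ : ∀ x : F, x ∈ 𝒪[F] → θ x = 1) :
    IsLocallyConstant θ := by
  refine (IsLocallyConstant.iff_exists_open _).2 fun x => ?_
  refine ⟨(fun y => y - x) ⁻¹' (𝒪[F] : Set F),
    (Valuation.isOpen_integer (v := ValuativeRel.valuation F)).preimage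
      (continuous_id.sub continuous_const), ?_, fun y hy => ?_⟩
  · simp
  · rw [← sub_add_cancel y x, AddChar.map_add_eq_mul, hθ _ hy, one_mul]

/-- Averaging `v` against `θ⁻¹` over the lattice `a⁻¹𝔬^{n+1}` in `U_{n+2}` gives a `θ`-eigenvector
of this lattice. Every linear map for which `v` already behaves as a `θ`-eigenvector of the
lattice takes the same value on the average as on `v`. -/
theorem exists_theta_eigenvector {θ : AddChar F ℂ} (hθ : ∀ x : F, x ∈ 𝒪[F] → θ x = 1) {n : ℕ}
    (τ : Representation ℂ (P F (n + 2)) V) (hτ : IsSmooth τ) {a : 𝒪[F]} (ha : a ≠ 0) (v : V)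
    (W : Type*) [AddCommGroup W] [Module ℂ W] :
    ∃ v' : V, (∀ x : Fin (n + 1) → F, (∀ i, (a : F) * x i ∈ 𝒪[F]) →
        τ (affine 1 x) v' = θ (x (Fin.last n)) • v') ∧
      ∀ f : V →ₗ[ℂ] W, (∀ x : Fin (n + 1) → F, (∀ i, (a : F) * x i ∈ 𝒪[F]) →
        f (τ (affine 1 x) v) = θ (x (Fin.last n)) • f v) → f v' = f v := by
  have ha' : (a : F) ≠ 0 := fun h => ha (Subtype.ext h)
  let s : (Fin (n + 1) → 𝒪[F]) → Fin (n + 1) → F := fun x i => (a : F)⁻¹ * x i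
  have hs_add : ∀ x y, s (x + y) = s x + s y := fun x y => funext fun i => by
    simp [s, mul_add]
  have hs_zero : s 0 = 0 := funext fun i => by simp [s]
  have hs_cont : Continuous s := by fun_prop
  have hs_int : ∀ x i, (a : F) * s x i ∈ 𝒪[F] := fun x i => by
    simp [s, mul_inv_cancel_left₀ ha']
  have hs_surj : ∀ x : Fin (n + 1) → F, (∀ i, (a : F) * x i ∈ 𝒪[F]) → ∃ y, s y = x :=
    fun x hx => ⟨fun i => ⟨_, hx i⟩, funext fun i => inv_mul_cancel_left₀ ha' _⟩
  let e : Multiplicative (Fin (n + 1) → 𝒪[F]) →* P F (n + 2) :=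
    { toFun := fun x => affine 1 (s x.toAdd)
      map_one' := by rw [toAdd_one, hs_zero, affine_one]
      map_mul' := fun x y => by
        rw [toAdd_mul, hs_add, affine_mul, Units.val_one, Matrix.one_mulVec, mul_one, add_comm (s _)] }
  let χ : Multiplicative (Fin (n + 1) → 𝒪[F]) →* ℂ :=
    { toFun := fun x => θ (-(s x.toAdd (Fin.last n)))
      map_one' := by simp [hs_zero]
      map_mul' := fun x y => by
        rw [toAdd_mul, hs_add, Pi.add_apply, neg_add, AddChar.map_add_eq_mul] }
  have hχ : ∀ x, χ x * θ (s x.toAdd (Fin.last n)) = 1 := fun x => by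
    change θ _ * θ _ = 1
    rw [← AddChar.map_add_eq_mul, neg_add_cancel, AddChar.map_zero_eq_one]
  have hconst : IsLocallyConstant fun x => twist (τ.comp e) χ x v := by
    have he : Continuous e :=
      continuous_affine.comp (continuous_const.prodMk (hs_cont.comp continuous_toAdd))
    have hc : Continuous fun x : Multiplicative (Fin (n + 1) → 𝒪[F]) =>
        -(s x.toAdd (Fin.last n)) :=
      ((continuous_apply _).comp (hs_cont.comp continuous_toAdd)).neg
    exact ((isLocallyConstant_addChar hθ).comp_continuous hc).comp₂
      ((hτ.isLocallyConstant v).comp_continuous he) (fun z y => z • y)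
  have : CompactSpace (Multiplicative (Fin (n + 1) → 𝒪[F])) :=
    inferInstanceAs (CompactSpace (Fin (n + 1) → 𝒪[F]))
  obtain ⟨T, hvT, hT, hinv⟩ := exists_finset_orbit (twist (τ.comp e) χ) v hconst
  have hcard : (T.card : ℂ) ≠ 0 := Nat.cast_ne_zero.2 (Finset.card_ne_zero_of_mem hvT)
  refine ⟨(T.card : ℂ)⁻¹ • ∑ y ∈ T, y, fun x hx => ?_, fun f hf => ?_⟩
  · obtain ⟨y, rfl⟩ := hs_surj x hx
    have h : χ (.ofAdd y) • τ (affine 1 (s y)) (∑ y ∈ T, y) = ∑ y ∈ T, y := hinv (.ofAdd y)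
    have hy := hχ (.ofAdd y)
    rw [toAdd_ofAdd] at hy
    rw [map_smul, smul_comm]
    congr 1
    conv_rhs => rw [← h, smul_smul, mul_comm, hy, one_smul]
  · rw [map_smul, map_sum, Finset.sum_congr rfl (g := fun _ => f v), Finset.sum_const,
      ← Nat.cast_smul_eq_nsmul ℂ, inv_smul_smul₀ hcard]
    intro y hy
    obtain ⟨x, rfl⟩ := hT y hy
    change f (χ x • τ (affine 1 (s x.toAdd)) v) = f v
    rw [map_smul, hf _ (hs_int _), smul_smul, hχ, one_smul]

/-! ### Surjectivity for `Φ⁻` -/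

/-- If the last row of `A` is not congruent to `(0, …, 0, 1)` modulo `a`, then `A` moves the
restriction of `θ` to the lattice `a⁻¹𝔬^{n+1}`. -/
theorem exists_theta_mulVec_last_ne {θ : AddChar F ℂ} (hθ : HasConductorO θ) {n : ℕ} {a : 𝒪[F]}
    {A : Matrix (Fin (n + 1)) (Fin (n + 1)) 𝒪[F]}
    (hA : ¬ ∀ j, a ∣ A (Fin.last n) j -
      (1 : Matrix (Fin (n + 1)) (Fin (n + 1)) 𝒪[F]) (Fin.last n) j) :
    ∃ x : Fin (n + 1) → F, (∀ i, (a : F) * x i ∈ 𝒪[F]) ∧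
      θ ((A.map (algebraMap 𝒪[F] F) *ᵥ x) (Fin.last n)) ≠ θ (x (Fin.last n)) := by
  obtain ⟨j, hj⟩ := not_forall.1 hA
  obtain ⟨x₀, hx₀, hne⟩ := hθ.nontrivial_on
  set r := A (Fin.last n) j - (1 : Matrix (Fin (n + 1)) (Fin (n + 1)) 𝒪[F]) (Fin.last n) j with hr
  have hr0 : (r : F) ≠ 0 := fun h => hj (by
    rw [show r = 0 from Subtype.ext h]
    exact dvd_zero a)
  -- In the valuation ring `𝔬`, `a ∤ r` forces `a / r` to lie in `𝔭`.
  obtain ⟨c, hc⟩ := (ValuationRing.dvd_total a r).resolve_left hj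
  have hcm : c ∈ 𝓂[F] := by
    refine (IsLocalRing.mem_maximalIdeal c).2 fun hu => hj ?_
    rw [hc]
    exact hu.mul_right_dvd.2 dvd_rfl
  refine ⟨Pi.single j (x₀ / r), fun i => ?_, fun h => hne ?_⟩
  · by_cases hi : i = j
    · subst hi
      rw [Pi.single_eq_same, hc, Subring.coe_mul, mul_comm (r : F), mul_assoc,
        mul_div_cancel₀ _ hr0]
      exact hx₀ c hcm
    · rw [Pi.single_eq_of_ne hi, mul_zero]
      exact zero_mem _
  · rw [mulVec_last_eq_add, AddChar.map_add_eq_mul] at h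
    have h2 := mul_left_cancel₀ (θ.val_isUnit _).ne_zero (h.trans (mul_one _).symm)
    rw [Finset.sum_eq_single j, Pi.single_eq_same, ← hr, mul_div_cancel₀ _ hr0] at h2
    · exact h2
    · intro i _ hi
      rw [Pi.single_eq_of_ne hi, mul_zero]
    · simp

theorem map_fixedVectors_PhiMinus {θ : AddChar F ℂ} (hθ : HasConductorO θ) {n : ℕ}
    (τ : Representation ℂ (P F (n + 2)) V) (hτ : IsSmooth τ) :
    (fixedVectors τ (PO F (n + 2))).map (Submodule.mkQ _) =
      fixedVectors (PhiMinus θ τ) (PO F (n + 1)) := by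
  have hθU : ∀ (x : Fin (n + 1) → F) (v : V),
      (twistedSpan τ (U F (n + 1)) (thetaU θ n)).mkQ (τ (affine 1 x) v) =
        θ (x (Fin.last n)) • (twistedSpan τ (U F (n + 1)) (thetaU θ n)).mkQ v := fun x v => by
    have hx : affine 1 x ∈ U F (n + 1) := ⟨x, rfl⟩
    rw [mk_twistedSpan_apply τ hx, thetaU_affine]
  have hcomm : ∀ (k : GL (Fin (n + 1)) 𝒪[F]) (x : Fin (n + 1) → F) (v : V),
      τ (diagO F (n + 1) k) (τ (affine 1 x) v) =
        τ (affine 1 (k.val.map (algebraMap 𝒪[F] F) *ᵥ x)) (τ (diagO F (n + 1) k) v) :=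
    fun k x v => by
      rw [← Module.End.mul_apply, ← Module.End.mul_apply, ← map_mul, ← map_mul,
        diagO_mul_affine_one]
  ext w
  constructor
  · rintro ⟨v, hv, rfl⟩
    refine mem_fixedVectors.2 ?_
    rintro ⟨_, hg⟩ ⟨k, rfl⟩
    rw [PhiMinus_mkQ θ τ (k := k) rfl, mem_fixedVectors.1 hv _ (diagO_mem_PO k)]
  intro hw
  obtain ⟨v, rfl⟩ := Submodule.mkQ_surjective _ w
  have := compactSpace_GL_integer (F := F) (n + 1)
  set q := (twistedSpan τ (U F (n + 1)) (thetaU θ n)).mkQ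
  -- The integral `k` that fix the image of `v` form an open set.
  have hW := (((hτ.isLocallyConstant v).comp_continuous (continuous_diagO (n + 1))).comp
    q).isOpen_fiber (q v)
  obtain ⟨a, ha, haW⟩ := exists_congruence_subset hW fun k hk => by
    have hkP : Matrix.GeneralLinearGroup.map (algebraMap 𝒪[F] F) k ∈ P F (n + 1) := by
      intro i j hi
      obtain rfl : i = Fin.last n := Fin.ext (by simpa using hi)
      change algebraMap 𝒪[F] F (k.val (Fin.last n) j) = _
      rw [hk j, Matrix.one_apply, Matrix.one_apply, apply_ite (algebraMap 𝒪[F] F), map_one,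
        map_zero]
    exact (PhiMinus_mkQ θ τ (p := ⟨_, hkP⟩) rfl v).symm.trans
      (mem_fixedVectors.1 hw ⟨_, hkP⟩ ⟨k, rfl⟩)
  obtain ⟨v', hv', hf⟩ := exists_theta_eigenvector hθ.trivial_on τ hτ ha v
    (V ⧸ twistedSpan τ (U F (n + 1)) (thetaU θ n))
  have hqv' : q v' = q v := hf q fun x _ => hθU x v
  -- Such `k` preserve `θ` on the lattice, so `k v'` still maps to the image of `v`.
  have hgood : ∀ k : GL (Fin (n + 1)) 𝒪[F],
      (∀ j, a ∣ k.val (Fin.last n) j -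
        (1 : Matrix (Fin (n + 1)) (Fin (n + 1)) 𝒪[F]) (Fin.last n) j) →
      q (τ (diagO F (n + 1) k) v') = q v' := fun k hk => by
    rw [hqv', ← show q (τ (diagO F (n + 1) k) v) = q v from haW k hk]
    refine hf (q ∘ₗ τ (diagO F (n + 1) k)) fun x hx => ?_
    rw [LinearMap.comp_apply, LinearMap.comp_apply, hcomm, hθU,
      theta_mulVec_last hθ.trivial_on hk hx]
  -- Every other `k` makes `k v'` an eigenvector for a character different from `θ`.
  have hbad : ∀ k : GL (Fin (n + 1)) 𝒪[F],
      (¬ ∀ j, a ∣ k.val (Fin.last n) j -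
        (1 : Matrix (Fin (n + 1)) (Fin (n + 1)) 𝒪[F]) (Fin.last n) j) →
      q (τ (diagO F (n + 1) k) v') = 0 := fun k hk => by
    obtain ⟨x, hx, hne⟩ := exists_theta_mulVec_last_ne hθ hk
    have h := congrArg q (hcomm k x v')
    rw [hv' x hx, map_smul, map_smul, hθU, ← sub_eq_zero, ← sub_smul] at h
    exact (smul_eq_zero.1 h).resolve_left (sub_ne_zero.2 hne.symm)
  obtain ⟨T, hvT, hT, hinv⟩ := exists_finset_orbit (τ.comp (diagO F (n + 1))) v'
    ((hτ.isLocallyConstant v').comp_continuous (continuous_diagO (n + 1)))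
  obtain ⟨c, hc⟩ := exists_smul_sum_eq q T hvT fun y hy => by
    obtain ⟨k, rfl⟩ := hT y hy
    exact (em _).imp (hgood k) (hbad k)
  refine ⟨_, mem_fixedVectors.2 fun p hp => ?_, hc.trans hqv'⟩
  obtain ⟨k, x, hx, rfl⟩ := exists_eq_of_mem_PO hp
  rw [map_smul, map_mul, Module.End.mul_apply,
    show τ (diagO F (n + 1) k) (∑ y ∈ T, y) = _ from hinv k, map_sum]
  congr 1
  refine Finset.sum_congr rfl fun y hy => ?_
  obtain ⟨l, rfl⟩ := hT y hy
  -- Integral translations fix `v'`, and `GL(n + 1, 𝔬)` normalizes them.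
  have hlx : ∀ i, ((l⁻¹).val.map (algebraMap 𝒪[F] F) *ᵥ x) i ∈ 𝒪[F] :=
    mulVec_mem_integer (fun i j => ((l⁻¹).val i j).2) hx
  have h := hcomm l ((l⁻¹).val.map (algebraMap 𝒪[F] F) *ᵥ x) v'
  rw [hv' _ fun i => mul_mem a.2 (hlx i), hθ.trivial_on _ (hlx _), one_smul,
    Matrix.mulVec_mulVec, ← Matrix.map_mul, Units.mul_inv,
    Matrix.map_one _ (map_zero _) (map_one _), Matrix.one_mulVec] at h
  exact h.symm

end Mirabolic

theorem mainTheorem5 {F : Type*} [Field F] [ValuativeRel F] [TopologicalSpace F]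
    [IsNonarchimedeanLocalField F] (θ : AddChar F ℂ) (hθ : Mirabolic.HasConductorO θ)
    {V : Type*} [AddCommGroup V] [Module ℂ V] (n : ℕ) :
    (∀ τ : Representation ℂ (Mirabolic.P F (n + 2)) V, Mirabolic.IsSmooth τ →
      (Mirabolic.fixedVectors τ (Mirabolic.PO F (n + 2))).map (Submodule.mkQ _) =
        Mirabolic.fixedVectors (Mirabolic.PhiMinus θ τ) (Mirabolic.PO F (n + 1))) ∧
    (∀ τ : Representation ℂ (Mirabolic.P F (n + 1)) V, Mirabolic.IsSmooth τ →
      (Mirabolic.fixedVectors τ ((Mirabolic.GO F n).map (Mirabolic.diagG F n))).map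
          (Submodule.mkQ _) =
        Mirabolic.fixedVectors (Mirabolic.PsiMinus τ) (Mirabolic.GO F n)) :=
  ⟨Mirabolic.map_fixedVectors_PhiMinus hθ, Mirabolic.map_fixedVectors_PsiMinus⟩
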